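/- **Notation.** For $x\in\mathbb R$ let $\|x\|_{\mathbb T}=|\arg(e^{\imath x})|$, with $\arg$ taking values in $(-\pi,\pi]$. Let $X\subset(-\frac{\pi}{2},\frac{\pi}{2}]$ be a set of $n\ge 1$ distinct nodes, let $\Delta=\Delta(X)=\min_{x\ne y\in X}\|x-y\|_{\mathbb T}$ be its minimal separation (for $n=1$ put $\Delta=0$; then only $\Delta^0=1$ occurs below), and let $V_n=V_n(X)=\big[e^{\imath kx}\big]_{k=0,\dots,n-1}^{x\in X}\in\mathbb C^{n\times n}$ be the square Vandermonde matrix, with singular values $\sigma_1(V_n)\ge\dots\ge\sigma_n(V_n)$. Suppose that $X$ forms a multi-cluster configuration: for some $\eta>0$ there is a partition $X=\bigcup_{j=1}^M\mathcal C^{(j)}$ into nonempty sets, with sizes $n^{(j)}=\#\mathcal C^{(j)}$, and there are real numbers $\nu^{(1)},\dots,\nu^{(M)}$, such that for every $j$ 1. $\Delta\le\|y-x\|_{\mathbb T}\le\nu^{(j)}\Delta$ for all distinct $x,y\in\mathcal C^{(j)}$; 2. $\|x-y\|_{\mathbb T}\ge\eta$ for all $x\in\mathcal C^{(j)}$ and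 $y\in X\setminus\mathcal C^{(j)}$. Put $s=\max_j n^{(j)}$, and for $1\le m\le s$ put $\ell_m=\#\{1\le j\le M: m\le n^{(j)}\}$ and $$\sigma_{m,i}(V_n)=\sigma_{\ell_1+\dots+\ell_{m-1}+i}(V_n),\qquad i=1,\dots,\ell_m .$$ **Theorem.** For all $n$, $\nu\in\mathbb R$ and $\eta>0$ there are constants $c,C>0$, depending only on $n,\nu,\eta$ (in particular not on $\Delta$), such that for every such $X$ with $\#X=n$ and $\max_j\nu^{(j)}\le\nu$ one has $\ell_1+\dots+\ell_s=n$, so that the groups $\{\sigma_{m,i}(V_n)\}_{i=1}^{\ell_m}$, $m=1,\dots,s$, exhaust all the singular values of $V_n$, and $$c\,\Delta^{m-1}\le\sigma_{m,i}(V_n)\le C\,\Delta^{m-1}\qquad(1\le m\le s,\ 1\le i\le\ell_m).$$ That is, $\{\sigma_{1,i}(V_n)\}_{i=1}^{\ell_1}\asymp\Delta^0,\ \dots,\ \{\sigma_{s,i}(V_n)\}_{i=1}^{\ell_s}\asymp\Delta^{s-1}$. -/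

import Mathlib

noncomputable section

namespace SuperResolution

/-- The wrap-around modulus `‖x‖_𝕋 = |arg (e^{ix})|`, with the principal argument in `(-π, π]`. -/
def torusNorm (x : ℝ) : ℝ := |Complex.arg (Complex.exp (Complex.I * (x : ℂ)))|

/-- The minimal separation `Δ(X) = min_{x ≠ y} ‖x - y‖_𝕋` of a finite set of nodes. The set of
distances is finite, so the infimum is a minimum as soon as `X` has two points; it is `0` if `X`
has at most one point. -/
def minSep (X : Finset ℝ) : ℝ :=
  sInf {d : ℝ | ∃ x ∈ X, ∃ y ∈ X, x ≠ y ∧ d = torusNorm (x - y)}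

/-- `X` is an `(h, ν, n)`-cluster: it has `n` nodes, and any two distinct nodes of it are at
distance between `h` and `ν * h`. -/
def IsCluster (X : Finset ℝ) (h ν : ℝ) (n : ℕ) : Prop :=
  X.card = n ∧ ∀ x ∈ X, ∀ y ∈ X, x ≠ y → h ≤ torusNorm (y - x) ∧ torusNorm (y - x) ≤ ν * h

/-- `X` forms an `((h j, ν j, k j)_{j}, η)`-clustered configuration with `M` clusters: there is a
partition of `X` into `M` nonempty sets, the `j`-th of which is an `(h j, ν j, k j)`-cluster at
distance at least `η > 0` from the rest of `X`. -/
def IsClusteredConfiguration (X : Finset ℝ) {M : ℕ} (h ν : Fin M → ℝ) (k : Fin M → ℕ)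
    (η : ℝ) : Prop :=
  0 < η ∧ ∃ P : Fin M → Finset ℝ,
    (∀ j, (P j).Nonempty) ∧
    (∀ i j, i ≠ j → Disjoint (P i) (P j)) ∧
    Finset.univ.biUnion P = X ∧
    ∀ j, IsCluster (P j) (h j) (ν j) (k j) ∧
      ∀ x ∈ P j, ∀ y ∈ X \ P j, η ≤ torusNorm (x - y)

/-- The Vandermonde matrix `V(X; S) = [e^{ikx}]`, rows indexed by `k ∈ S`, columns by `x ∈ X`. -/
def vandermonde (X : Finset ℝ) (S : Finset ℤ) : Matrix S X ℂ :=
  Matrix.of fun k x => Complex.exp (Complex.I * ((k : ℤ) : ℂ) * ((x : ℝ) : ℂ))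

/-- The square Vandermonde matrix `V_n(X) = V(X; {0, …, n - 1})`, where `n = #X`. -/
def squareVandermonde (X : Finset ℝ) : Matrix (Finset.Ico (0 : ℤ) (X.card : ℤ)) X ℂ :=
  vandermonde X (Finset.Ico (0 : ℤ) (X.card : ℤ))

/-- The largest cluster size `s = max_j k j`. -/
def maxSize {M : ℕ} (k : Fin M → ℕ) : ℕ := Finset.univ.sup k

/-- `ℓ_m = #{j : m ≤ k j}`, the number of clusters with at least `m` nodes. -/
def numClusters {M : ℕ} (k : Fin M → ℕ) (m : ℕ) : ℕ :=
  (Finset.univ.filter fun j => m ≤ k j).card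

/-- The `i`-th singular value `σ_{m,i}`, `i = 1, …, ℓ_m`, in the `m`-th group, `m = 1, …, s`, when
the non-increasing sequence of singular values of `A` (with multiplicity) is cut into consecutive
groups of lengths `ℓ_1, ℓ_2, …, ℓ_s`; that is, the singular value number
`ℓ_1 + ⋯ + ℓ_{m-1} + i`. Mathlib numbers singular values from `0`. -/
def groupSingularValue {κ ι : Type*} [Fintype κ] [Fintype ι] [DecidableEq ι]
    (A : Matrix κ ι ℂ) (l : ℕ → ℕ) (m i : ℕ) : ℝ :=
  (Matrix.toEuclideanLin A).singularValues ((∑ r ∈ Finset.Ico 1 m, l r) + i - 1)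

end SuperResolution

end

/-!
The upper bounds come from the min-max principle. Choose a node `x_j` in each cluster `P j`. If the
moments `∑_{x ∈ P j} a_x (x - x_j) ^ r`, `r < min (m - 1) n_j`, vanish for all `j`, then
`‖V_n a‖ = O(Δ ^ (m - 1)) ‖a‖`: for a cluster with at least `m - 1` nodes by Taylor's formula, and
for a smaller one because the moment conditions force `a` to vanish on it
(`norm_sum_mul_exp_le_of_min_moments`). There are `∑ j, min (m - 1) n_j = ℓ_1 + ⋯ + ℓ_{m-1}`
conditions, so every singular value from the `m`-th group on is `O(Δ ^ (m - 1))`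
(`singularValues_squareVandermonde_le`).

The lower bounds follow from the upper ones and the determinant. The product of the singular values
is `|det V_n|`, which by Vandermonde's formula is a product of chords, those inside clusters being
at least of order `Δ` and all others bounded below
(`le_sq_prod_singularValues_squareVandermonde`). Hence `|det V_n| ≥ c Δ ^ E` with
`E = ∑ j, n_j (n_j - 1) / 2`. Double counting gives `E = ∑ m, (m - 1) ℓ_m`, the sum of the exponents
in the upper bounds, so dividing the determinant by the upper bounds for all singular values but one
bounds the remaining one from below by the right power of `Δ` (`le_of_prod_le`).
-/

open SuperResolution Finset

/-! ### Singular values and determinants -/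

open Module in
/-- One half of the Courant–Fischer min-max principle: a bound for `T` on a subspace cut out by at
most `k` linear conditions bounds the singular value number `k` (counted from `0`). -/
theorem LinearMap.singularValues_le_of_norm_le_on_ker {𝕜 E F ι : Type*} [RCLike 𝕜]
    [NormedAddCommGroup E] [InnerProductSpace 𝕜 E] [FiniteDimensional 𝕜 E]
    [NormedAddCommGroup F] [InnerProductSpace 𝕜 F] [FiniteDimensional 𝕜 F] [Fintype ι]
    (T : E →ₗ[𝕜] F) (f : E →ₗ[𝕜] ι → 𝕜) {k : ℕ} (hk : Fintype.card ι ≤ k) {B : ℝ} (hB : 0 ≤ B)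
    (h : ∀ v, f v = 0 → ‖T v‖ ≤ B * ‖v‖) : T.singularValues k ≤ B := by
  rcases le_or_gt (finrank 𝕜 E) k with hkn | hkn
  · rwa [T.singularValues_of_finrank_le hkn]
  set hT := T.isSymmetric_adjoint_comp_self
  set b := hT.eigenvectorBasis rfl with hb
  -- A nonzero `v` in the kernel of `f` that is a combination of the first `k + 1` right singular
  -- vectors exists because `f` and the remaining coordinates impose fewer than `dim E` conditions.
  let g : E →ₗ[𝕜] (ι → 𝕜) × ({i : Fin (finrank 𝕜 E) // k < i} → 𝕜) :=
    f.prod (LinearMap.pi fun i ↦ b.toBasis.coord i.1)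
  have hcard : Fintype.card {i : Fin (finrank 𝕜 E) // k < i} = finrank 𝕜 E - (k + 1) := by
    rw [Fintype.card_subtype]
    have : (univ.filter fun i : Fin (finrank 𝕜 E) ↦ k < i)
        = Ioi (⟨k, hkn⟩ : Fin (finrank 𝕜 E)) := by
      ext i; simp [Fin.lt_def]
    rw [this, Fin.card_Ioi]
    simp only; omega
  have hg : LinearMap.ker g ≠ ⊥ := by
    apply LinearMap.ker_ne_bot_of_finrank_lt
    rw [Module.finrank_prod, Module.finrank_fintype_fun_eq_card,
      Module.finrank_fintype_fun_eq_card, hcard]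
    omega
  obtain ⟨v, hv, hv0⟩ := Submodule.exists_mem_ne_zero_of_ne_bot hg
  have hv' : f v = 0 ∧ (fun i : {i : Fin (finrank 𝕜 E) // k < i} ↦ b.repr v i.1) = 0 := by
    have := LinearMap.mem_ker.1 hv
    refine ⟨congrArg Prod.fst this, funext fun i ↦ ?_⟩
    have hi : b.toBasis.coord i.1 v = 0 := congrFun (congrArg Prod.snd this) i
    simpa using hi
  have hTv : ‖T v‖ ^ 2 = ∑ i, hT.eigenvalues rfl i * ‖b.repr v i‖ ^ 2 := by
    have h1 : (‖T v‖ ^ 2 : ℝ) = RCLike.re (inner 𝕜 v ((LinearMap.adjoint T ∘ₗ T) v)) := by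
      rw [LinearMap.comp_apply, LinearMap.adjoint_inner_right, inner_self_eq_norm_sq]
    rw [h1, ← b.repr.inner_map_map, PiLp.inner_apply, map_sum]
    refine sum_congr rfl fun i _ ↦ ?_
    rw [hb, hT.eigenvectorBasis_apply_self_apply rfl, ← hb, RCLike.inner_apply, mul_assoc,
      RCLike.mul_conj, ← RCLike.ofReal_pow, ← RCLike.ofReal_mul, RCLike.ofReal_re]
  have hvn : ‖v‖ ^ 2 = ∑ i, ‖b.repr v i‖ ^ 2 := by
    rw [← b.repr.norm_map, EuclideanSpace.norm_sq_eq]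
  have hle : T.singularValues k ^ 2 * ‖v‖ ^ 2 ≤ ‖T v‖ ^ 2 := by
    rw [hTv, hvn, mul_sum, T.sq_singularValues_of_lt rfl hkn]
    refine sum_le_sum fun i _ ↦ ?_
    rcases le_or_gt (i : ℕ) k with hi | hi
    · gcongr
      exact hT.eigenvalues_antitone rfl (Fin.le_def.2 hi)
    · have := congrFun hv'.2 ⟨i, hi⟩
      simp only [Pi.zero_apply] at this
      simp [this]
  have hvpos : 0 < ‖v‖ := norm_pos_iff.2 hv0
  rw [← mul_pow] at hle
  have h2 := abs_le_of_sq_le_sq hle (norm_nonneg _)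
  exact le_of_mul_le_mul_right ((le_abs_self _).trans (h2.trans (h v hv'.1))) hvpos

theorem Matrix.prod_singularValues_toEuclideanLin {κ ι : Type*} [Fintype κ] [Fintype ι]
    [DecidableEq ι] {n : ℕ} (A : Matrix κ ι ℂ) (e : Fin n ≃ κ) (e' : Fin n ≃ ι) :
    ∏ k ∈ range n, (Matrix.toEuclideanLin A).singularValues k
      = ‖(A.submatrix e e').det‖ := by
  have hn : Module.finrank ℂ (EuclideanSpace ℂ ι) = n := by
    simp [← Fintype.card_congr e']
  have h := (Matrix.toEuclideanLin A).normDet_eq_prod_singularValues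
  rw [hn] at h
  rw [← h, LinearMap.normDet_eq_norm_det_toMatrix _ ((EuclideanSpace.basisFun ι ℂ).reindex e'.symm)
    ((EuclideanSpace.basisFun κ ℂ).reindex e.symm)]
  congr 2
  ext i j
  simp [LinearMap.toMatrix_apply]

theorem Matrix.norm_det_vandermonde_sq {n : ℕ} (v : Fin n → ℂ) :
    ‖(Matrix.vandermonde v).det‖ ^ 2 = ∏ i, ∏ j ∈ {i}ᶜ, ‖v j - v i‖ := by
  rw [← prod_prod_Ioi_mul_eq_prod_prod_off_diag, Matrix.det_vandermonde, norm_prod,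
    ← prod_pow]
  refine prod_congr rfl fun i _ ↦ ?_
  rw [norm_prod, ← prod_pow]
  refine prod_congr rfl fun j _ ↦ ?_
  rw [norm_sub_rev (v i), sq]

namespace SuperResolution

/-! ### Counting clusters -/

/-- Double counting of the pairs `(m, j)` with `m ≤ k j`. -/
theorem sum_numClusters_mul {M : ℕ} (k : Fin M → ℕ) (a : ℕ) (g : ℕ → ℕ) :
    ∑ m ∈ Ico 1 a, numClusters k m * g m = ∑ j, ∑ m ∈ Ico 1 (min a (k j + 1)), g m := by
  have h (m : ℕ) : numClusters k m * g m = ∑ j, if m ≤ k j then g m else 0 := by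
    rw [numClusters, card_filter, sum_mul]
    exact sum_congr rfl fun j _ ↦ by split_ifs <;> simp
  simp_rw [h]
  rw [sum_comm]
  refine sum_congr rfl fun j _ ↦ ?_
  rw [← sum_filter]
  congr 1
  ext m
  simp only [mem_filter, mem_Ico, lt_min_iff, Order.lt_add_one_iff]
  tauto

theorem sum_numClusters_Ico {M : ℕ} (k : Fin M → ℕ) {m : ℕ} (hm : 1 ≤ m) :
    ∑ r ∈ Ico 1 m, numClusters k r = ∑ j, min (m - 1) (k j) := by
  have := sum_numClusters_mul k m fun _ ↦ 1
  simp only [mul_one, sum_const, smul_eq_mul, Nat.card_Ico] at this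
  rw [this]
  exact sum_congr rfl fun j _ ↦ by omega

theorem le_maxSize {M : ℕ} (k : Fin M → ℕ) (j : Fin M) : k j ≤ maxSize k :=
  le_sup (f := k) (mem_univ j)

theorem sum_numClusters {M : ℕ} (k : Fin M → ℕ) :
    ∑ m ∈ Icc 1 (maxSize k), numClusters k m = ∑ j, k j := by
  have := sum_numClusters_Ico k (m := maxSize k + 1) (by omega)
  rw [← Ico_add_one_right_eq_Icc, this]
  exact sum_congr rfl fun j _ ↦ by have := le_maxSize k j; omega

/-- The exponents `m - 1` of the singular values add up to the exponent of the minimal separation in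
the Vandermonde determinant. -/
theorem two_mul_sum_numClusters_mul_pred {M : ℕ} (k : Fin M → ℕ) :
    2 * ∑ m ∈ Icc 1 (maxSize k), numClusters k m * (m - 1) = ∑ j, k j * (k j - 1) := by
  rw [← Ico_add_one_right_eq_Icc, sum_numClusters_mul k _ fun m ↦ m - 1, mul_sum]
  refine sum_congr rfl fun j _ ↦ ?_
  rw [min_eq_right (by have := le_maxSize k j; omega), sum_Ico_eq_sum_range, mul_comm,
    ← sum_range_id_mul_two]
  simp

/-- A product over an initial segment of `ℕ`, cut into consecutive blocks of lengths
`l 1, …, l s`. -/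
theorem prod_range_eq_prod_blocks {α : Type*} [CommMonoid α] (f : ℕ → α) (l : ℕ → ℕ) (s : ℕ) :
    ∏ t ∈ range (∑ m ∈ Icc 1 s, l m), f t
      = ∏ m ∈ Icc 1 s, ∏ i ∈ Icc 1 (l m), f ((∑ r ∈ Ico 1 m, l r) + i - 1) := by
  induction s with
  | zero => simp
  | succ s ih =>
    rw [sum_Icc_succ_top (by omega), prod_Icc_succ_top (by omega), prod_range_add, ih,
      Ico_add_one_right_eq_Icc, ← Ico_add_one_right_eq_Icc 1 (l (s + 1)), prod_Ico_eq_prod_range]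
    simp only [add_tsub_cancel_right]
    congr 1
    refine prod_congr rfl fun i _ ↦ ?_
    congr 1
    omega

/-- If numbers `σ t` are at most `C * d t` and their product is at least a fixed fraction of
`∏ d t`, then each `σ t` is at least a fixed fraction of `d t`. -/
theorem le_of_prod_le {ι : Type*} [DecidableEq ι] {T : Finset ι} {σ d : ι → ℝ} {c C : ℝ}
    (hC : 1 ≤ C) (hd : ∀ t ∈ T, 0 < d t) (hσ : ∀ t ∈ T, 0 ≤ σ t)
    (hle : ∀ t ∈ T, σ t ≤ C * d t) (hprod : c * ∏ t ∈ T, d t ≤ ∏ t ∈ T, σ t) {t : ι}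
    (ht : t ∈ T) : c / C ^ #T * d t ≤ σ t := by
  have hsub : ∀ u ∈ T.erase t, u ∈ T := fun u hu ↦ mem_of_mem_erase hu
  have hpos : 0 < ∏ u ∈ T.erase t, d u := prod_pos fun u hu ↦ hd u (hsub u hu)
  have h1 : ∏ u ∈ T.erase t, σ u ≤ C ^ #T * ∏ u ∈ T.erase t, d u := by
    calc ∏ u ∈ T.erase t, σ u ≤ ∏ u ∈ T.erase t, (C * d u) :=
          prod_le_prod (fun u hu ↦ hσ u (hsub u hu)) fun u hu ↦ hle u (hsub u hu)
      _ = C ^ #(T.erase t) * ∏ u ∈ T.erase t, d u := by rw [prod_mul_distrib, prod_const]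
      _ ≤ _ := by gcongr; exact erase_subset _ _
  rw [← mul_prod_erase T d ht, ← mul_prod_erase T σ ht] at hprod
  rw [div_mul_eq_mul_div, div_le_iff₀ (by positivity)]
  refine le_of_mul_le_mul_right ?_ hpos
  calc c * d t * ∏ u ∈ T.erase t, d u ≤ σ t * ∏ u ∈ T.erase t, σ u := by rwa [mul_assoc]
    _ ≤ σ t * (C ^ #T * ∏ u ∈ T.erase t, d u) := mul_le_mul_of_nonneg_left h1 (hσ t ht)
    _ = _ := by ring

/-! ### Chords and exponential sums -/

theorem torusNorm_eq_abs {x : ℝ} (hx : |x| < Real.pi) : torusNorm x = |x| := by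
  obtain ⟨h1, h2⟩ := abs_lt.1 hx
  rw [torusNorm, mul_comm, Complex.arg_exp_mul_I, (toIocMod_eq_self Real.two_pi_pos).2]
  constructor <;> linarith

theorem minSep_nonneg (X : Finset ℝ) : 0 ≤ minSep X := by
  refine Real.sInf_nonneg ?_
  rintro d ⟨x, -, y, -, -, rfl⟩
  exact abs_nonneg _

theorem two_div_pi_mul_abs_le_norm_exp_sub {x y : ℝ} (h : |x - y| ≤ Real.pi) :
    2 / Real.pi * |x - y| ≤ ‖Complex.exp (Complex.I * y) - Complex.exp (Complex.I * x)‖ := by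
  have h1 : Complex.exp (Complex.I * y) - Complex.exp (Complex.I * x)
      = Complex.exp (Complex.I * y) * -(Complex.exp (Complex.I * ((x - y : ℝ) : ℂ)) - 1) := by
    have : Complex.I * (x : ℂ) = Complex.I * y + Complex.I * ((x - y : ℝ) : ℂ) := by
      push_cast; ring
    rw [this, Complex.exp_add]
    ring
  rw [h1, norm_mul, norm_neg, Complex.norm_exp_I_mul_ofReal, one_mul,
    Complex.norm_exp_I_mul_ofReal_sub_one, norm_mul, Real.norm_eq_abs, Real.norm_eq_abs, abs_two]
  have h2 : |(x - y) / 2| = |x - y| / 2 := by rw [abs_div, abs_two]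
  have := Real.mul_abs_le_abs_sin (x := (x - y) / 2) (by rw [h2]; linarith)
  rw [h2] at this
  linarith

variable {ι : Type*} {Q : Finset ι} {z : ι → ℝ} {a : ι → ℂ} {x₀ : ℝ}

/-- Taylor expansion of `exp (i κ x)` at `x₀`: the moments of order below `q` kill its first `q`
terms. -/
theorem norm_sum_mul_exp_le_of_moments {q : ℕ} {κ δ ρ : ℝ} (hδ0 : 0 ≤ δ)
    (hδ : ∀ x ∈ Q, |z x - x₀| ≤ δ)
    (hρ : ∀ x ∈ Q, |z x - x₀| ≤ ρ)
    (hmom : ∀ r < q, ∑ x ∈ Q, a x * ((z x - x₀ : ℝ) : ℂ) ^ r = 0) :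
    ‖∑ x ∈ Q, a x * Complex.exp (Complex.I * κ * z x)‖
      ≤ (|κ| * δ) ^ q * Real.exp (|κ| * ρ) * ∑ x ∈ Q, ‖a x‖ := by
  let w (x : ι) : ℂ := Complex.I * κ * ((z x - x₀ : ℝ) : ℂ)
  have hw (x : ι) : ‖w x‖ = |κ| * |z x - x₀| := by
    simp only [w, norm_mul, Complex.norm_I, one_mul, Complex.norm_real, Real.norm_eq_abs]
  have h0 : ∑ x ∈ Q, a x * ∑ m ∈ range q, w x ^ m / m.factorial = 0 := by
    simp_rw [mul_sum]
    rw [sum_comm]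
    refine sum_eq_zero fun m hm ↦ ?_
    rw [← mul_zero ((Complex.I * κ) ^ m / (m.factorial : ℂ)), ← hmom m (mem_range.1 hm), mul_sum]
    refine sum_congr rfl fun x _ ↦ ?_
    simp only [w, mul_pow]
    ring
  have h1 : ∑ x ∈ Q, a x * Complex.exp (Complex.I * κ * z x)
      = Complex.exp (Complex.I * ((κ * x₀ : ℝ) : ℂ)) *
        ∑ x ∈ Q, a x * (Complex.exp (w x) - ∑ m ∈ range q, w x ^ m / m.factorial) := by
    simp_rw [mul_sub]
    rw [sum_sub_distrib, h0, sub_zero, mul_sum]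
    refine sum_congr rfl fun x _ ↦ ?_
    rw [mul_left_comm, ← Complex.exp_add]
    congr 2
    simp only [w]
    push_cast
    ring
  rw [h1, norm_mul, Complex.norm_exp_I_mul_ofReal, one_mul, mul_sum]
  refine norm_sum_le_of_le _ fun x hx ↦ ?_
  rw [norm_mul, mul_comm]
  gcongr
  refine (Complex.norm_exp_sub_sum_le_norm_mul_exp (w x) q).trans ?_
  rw [hw]
  gcongr
  exacts [hδ x hx, hρ x hx]

/-- A Vandermonde system: `#Q` vanishing moments at distinct nodes force all coefficients to
vanish. -/
theorem eq_zero_of_moments (hz : Set.InjOn z Q)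
    (hmom : ∀ r < #Q, ∑ x ∈ Q, a x * ((z x - x₀ : ℝ) : ℂ) ^ r = 0) : ∀ x ∈ Q, a x = 0 := by
  let e := Q.equivFin
  have hinj : Function.Injective fun i ↦ ((z (e.symm i) - x₀ : ℝ) : ℂ) := by
    intro i j hij
    have h1 : z (e.symm i) = z (e.symm j) := by simpa using hij
    exact e.symm.injective (Subtype.ext (hz (e.symm i).2 (e.symm j).2 h1))
  have := Matrix.eq_zero_of_forall_pow_sum_mul_pow_eq_zero (v := fun i ↦ a (e.symm i)) hinj
    fun r ↦ by
      rw [← hmom r r.2, ← sum_coe_sort Q]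
      exact Equiv.sum_comp e.symm fun x : Q ↦ a x * ((z x - x₀ : ℝ) : ℂ) ^ (r : ℕ)
  intro x hx
  simpa using congrFun this (e ⟨x, hx⟩)

/-- Vanishing of the moments of order below `min q #Q` already gives a bound of order `δ ^ q`: when
`#Q < q`, they force all coefficients to vanish. -/
theorem norm_sum_mul_exp_le_of_min_moments {q : ℕ} {κ δ ρ : ℝ} (hz : Set.InjOn z Q) (hδ0 : 0 ≤ δ)
    (hδ : ∀ x ∈ Q, |z x - x₀| ≤ δ) (hρ : ∀ x ∈ Q, |z x - x₀| ≤ ρ)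
    (hmom : ∀ r < min q #Q, ∑ x ∈ Q, a x * ((z x - x₀ : ℝ) : ℂ) ^ r = 0) :
    ‖∑ x ∈ Q, a x * Complex.exp (Complex.I * κ * z x)‖
      ≤ (|κ| * δ) ^ q * Real.exp (|κ| * ρ) * ∑ x ∈ Q, ‖a x‖ := by
  rcases le_total q #Q with h | h
  · rw [min_eq_left h] at hmom
    exact norm_sum_mul_exp_le_of_moments hδ0 hδ hρ hmom
  · rw [min_eq_right h] at hmom
    rw [sum_eq_zero fun x hx ↦ by rw [eq_zero_of_moments hz hmom x hx, zero_mul], norm_zero]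
    positivity

/-! ### Bounds for the square Vandermonde matrix -/

/-- Upper bound. On the subspace where, for each cluster, the moments of order below `min q #(P j)`
about a node of the cluster vanish, `V_n` has norm `O(δ ^ q)`; the subspace is cut out by
`∑ j, min q #(P j)` conditions. -/
theorem singularValues_squareVandermonde_le {X : Finset ℝ} {M : ℕ} {P : Fin M → Finset ℝ} {δ : ℝ}
    (hne : ∀ j, (P j).Nonempty) (hdisj : ∀ i j, i ≠ j → Disjoint (P i) (P j))
    (hunion : univ.biUnion P = X) (hδ0 : 0 ≤ δ)
    (hδ : ∀ j, ∀ x ∈ P j, ∀ y ∈ P j, |x - y| ≤ δ)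
    (hπ : ∀ x ∈ X, ∀ y ∈ X, |x - y| ≤ Real.pi) (q : ℕ) :
    (Matrix.toEuclideanLin (squareVandermonde X)).singularValues (∑ j, min q #(P j))
      ≤ #X ^ 2 * ((#X * δ) ^ q * Real.exp (#X * Real.pi)) := by
  choose x₀ hx₀ using hne
  have hPX (j : Fin M) : P j ⊆ X := hunion ▸ subset_biUnion_of_mem P (mem_univ j)
  let Q (j : Fin M) : Finset X := univ.filter fun x ↦ (x : ℝ) ∈ P j
  have hQcard (j : Fin M) : #(Q j) = #(P j) := by
    refine card_bij (fun x _ ↦ (x : ℝ)) (fun x hx ↦ (mem_filter.1 hx).2)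
      (fun x _ y _ h ↦ Subtype.ext h) fun y hy ↦ ⟨⟨y, hPX j hy⟩, by simpa [Q] using hy, rfl⟩
  have hQdisj : Set.PairwiseDisjoint ((univ : Finset (Fin M)) : Set (Fin M)) Q :=
    fun i _ j _ hij ↦ disjoint_filter.2 fun x _ h1 h2 ↦ disjoint_left.1 (hdisj i j hij) h1 h2
  have hQunion : univ.biUnion Q = univ := by
    ext x
    have hx : (x : ℝ) ∈ univ.biUnion P := hunion.symm ▸ x.2
    simpa [Q] using hx
  let f : EuclideanSpace ℂ X →ₗ[ℂ] ((j : Fin M) × Fin (min q #(P j))) → ℂ :=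
    { toFun := fun v p ↦ ∑ x ∈ Q p.1, v x * (((x : ℝ) - x₀ p.1 : ℝ) : ℂ) ^ (p.2 : ℕ)
      map_add' := fun v w ↦ by
        ext p
        simp only [PiLp.add_apply, add_mul, sum_add_distrib, Pi.add_apply]
      map_smul' := fun c v ↦ by
        ext p
        simp only [PiLp.smul_apply, smul_eq_mul, mul_assoc, mul_sum, Pi.smul_apply,
          RingHom.id_apply] }
  set β : ℝ := (#X * δ) ^ q * Real.exp (#X * Real.pi) with hβ
  have hβ0 : 0 ≤ β := by positivity
  refine LinearMap.singularValues_le_of_norm_le_on_ker _ f (by simp) (by positivity) fun v hv ↦ ?_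
  have hcoord (k : Ico (0 : ℤ) (#X : ℤ)) :
      ‖Matrix.toEuclideanLin (squareVandermonde X) v k‖ ≤ β * (#X * ‖v‖) := by
    have hk : |((k : ℤ) : ℝ)| ≤ #X := by
      have := mem_Ico.1 k.2
      rw [abs_of_nonneg (by exact_mod_cast this.1)]
      exact_mod_cast this.2.le
    have h1 : Matrix.toEuclideanLin (squareVandermonde X) v k
        = ∑ j, ∑ x ∈ Q j, v x * Complex.exp (Complex.I * ((k : ℤ) : ℝ) * (x : ℝ)) := by
      rw [← sum_biUnion hQdisj, hQunion]
      simp [Matrix.toLpLin_apply, Matrix.mulVec, dotProduct, squareVandermonde, vandermonde,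
        mul_comm]
    have h2 : ∑ x, ‖v x‖ ≤ #X * ‖v‖ := by
      have := sum_le_card_nsmul univ (fun x : X ↦ ‖v x‖) ‖v‖ fun x _ ↦ PiLp.norm_apply_le v x
      simpa using this
    rw [h1]
    calc _ ≤ ∑ j, β * ∑ x ∈ Q j, ‖v x‖ := by
          refine norm_sum_le_of_le _ fun j _ ↦ ?_
          refine (norm_sum_mul_exp_le_of_min_moments (q := q) (x₀ := x₀ j) (ρ := Real.pi)
            (Subtype.val_injective.injOn) hδ0
            (fun x hx ↦ hδ j x (mem_filter.1 hx).2 _ (hx₀ j))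
            (fun x hx ↦ hπ x x.2 _ (hPX j (hx₀ j))) fun r hr ↦ ?_).trans ?_
          · rw [hQcard] at hr
            exact congrFun hv ⟨j, ⟨r, hr⟩⟩
          · rw [hβ]
            gcongr
      _ = β * ∑ x, ‖v x‖ := by rw [← mul_sum, ← sum_biUnion hQdisj, hQunion]
      _ ≤ _ := by gcongr
  have hsq : ‖Matrix.toEuclideanLin (squareVandermonde X) v‖ ^ 2
      ≤ (#X * (β * (#X * ‖v‖))) ^ 2 := by
    rw [EuclideanSpace.norm_sq_eq]
    calc _ ≤ ∑ _k : Ico (0 : ℤ) (#X : ℤ), (β * (#X * ‖v‖)) ^ 2 := by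
          gcongr with k
          exact hcoord k
      _ = #X * (β * (#X * ‖v‖)) ^ 2 := by simp
      _ ≤ #X ^ 2 * (β * (#X * ‖v‖)) ^ 2 := by
          gcongr
          exact_mod_cast Nat.le_self_pow two_ne_zero _
      _ = _ := by ring
  calc _ ≤ _ := (le_abs_self _).trans (abs_le_of_sq_le_sq hsq (by positivity))
    _ = _ := by ring

/-- The product of the singular values of `V_n` is the modulus of its determinant; squaring turns the
Vandermonde product over unordered pairs of nodes into one over ordered pairs. -/
theorem sq_prod_singularValues_squareVandermonde (X : Finset ℝ) :
    (∏ t ∈ range #X, (Matrix.toEuclideanLin (squareVandermonde X)).singularValues t) ^ 2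
      = ∏ x ∈ X, ∏ y ∈ X.erase x,
        ‖Complex.exp (Complex.I * (y : ℂ)) - Complex.exp (Complex.I * (x : ℂ))‖ := by
  let e : Fin #X ≃ X := X.equivFin.symm
  let e' : Fin #X ≃ Ico (0 : ℤ) (#X : ℤ) :=
    { toFun := fun i ↦ ⟨i, by simp⟩
      invFun := fun k ↦ ⟨(k : ℤ).toNat, by have := mem_Ico.1 k.2; omega⟩
      left_inv := fun i ↦ by simp
      right_inv := fun k ↦ by
        have := mem_Ico.1 k.2
        ext
        simp [this.1] }
  have hV : (squareVandermonde X).submatrix e' e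
      = (Matrix.vandermonde fun i ↦ Complex.exp (Complex.I * ((e i : ℝ) : ℂ))).transpose := by
    ext i j
    simp only [squareVandermonde, vandermonde, Matrix.submatrix_apply, Matrix.of_apply,
      Matrix.transpose_apply, Matrix.vandermonde_apply, ← Complex.exp_nat_mul]
    congr 1
    simp only [e', Equiv.coe_fn_mk]
    push_cast
    ring
  rw [Matrix.prod_singularValues_toEuclideanLin _ e' e, hV, Matrix.det_transpose,
    Matrix.norm_det_vandermonde_sq, ← prod_coe_sort X, ← Equiv.prod_comp e]
  refine prod_congr rfl fun i _ ↦ ?_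
  refine prod_bij (fun j _ ↦ (e j : ℝ)) (fun j hj ↦ ?_) (fun j _ j' _ h ↦ ?_) (fun y hy ↦ ?_)
    fun j _ ↦ rfl
  · simp only [mem_compl, mem_singleton] at hj
    exact mem_erase.2 ⟨fun h ↦ hj (e.injective (Subtype.ext h)), (e j).2⟩
  · exact e.injective (Subtype.ext h)
  · obtain ⟨h1, h2⟩ := mem_erase.1 hy
    refine ⟨e.symm ⟨y, h2⟩, ?_, by simp⟩
    simp only [mem_compl, mem_singleton]
    rintro rfl
    simp at h1

/-- Lower bound for the square of the Vandermonde determinant: each ordered pair of distinct nodes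
contributes at least `κ * h` if both lie in one cluster and at least `κ` otherwise. The exponent of
`κ` is rounded up from the number of these pairs. -/
theorem le_sq_prod_singularValues_squareVandermonde {X : Finset ℝ} {M : ℕ}
    {P : Fin M → Finset ℝ} {h η κ : ℝ}
    (hdisj : ∀ i j, i ≠ j → Disjoint (P i) (P j)) (hunion : univ.biUnion P = X)
    (hin : ∀ j, ∀ x ∈ P j, ∀ y ∈ P j, x ≠ y → h ≤ |x - y|)
    (hout : ∀ j, ∀ x ∈ P j, ∀ y ∈ X \ P j, η ≤ |x - y|)
    (hπ : ∀ x ∈ X, ∀ y ∈ X, |x - y| ≤ Real.pi) (hh : 0 ≤ h) (hκ0 : 0 ≤ κ) (hκ1 : κ ≤ 2 / Real.pi)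
    (hκη : κ ≤ 2 / Real.pi * η) :
    κ ^ (#X * #X) * h ^ (∑ j, #(P j) * (#(P j) - 1)) ≤
      (∏ t ∈ range #X, (Matrix.toEuclideanLin (squareVandermonde X)).singularValues t) ^ 2 := by
  have hPX (j : Fin M) : P j ⊆ X := hunion ▸ subset_biUnion_of_mem P (mem_univ j)
  have hpd : Set.PairwiseDisjoint ((univ : Finset (Fin M)) : Set (Fin M)) P :=
    fun i _ j _ hij ↦ hdisj i j hij
  have hκ : κ ≤ 1 := hκ1.trans ((div_le_one Real.pi_pos).2 Real.two_le_pi)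
  have hcard : #X = ∑ j, #(P j) := by rw [← hunion, card_biUnion fun i _ j _ hij ↦ hdisj i j hij]
  have key : ∀ j, ∀ x ∈ P j, κ ^ #X * h ^ (#(P j) - 1) ≤ ∏ y ∈ X.erase x,
      ‖Complex.exp (Complex.I * (y : ℂ)) - Complex.exp (Complex.I * (x : ℂ))‖ := by
    intro j x hx
    have hfilter : (X.erase x).filter (· ∈ P j) = (P j).erase x := by
      ext y
      simp only [mem_filter, mem_erase]
      exact ⟨fun ⟨⟨a, _⟩, c⟩ ↦ ⟨a, c⟩, fun ⟨a, c⟩ ↦ ⟨⟨a, hPX j c⟩, c⟩⟩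
    calc κ ^ #X * h ^ (#(P j) - 1) ≤ κ ^ #(X.erase x) * h ^ (#(P j) - 1) := by
          gcongr ?_ * _
          exact pow_le_pow_of_le_one hκ0 hκ (card_le_card (erase_subset _ _))
      _ = ∏ y ∈ X.erase x, κ * (if y ∈ P j then h else 1) := by
          rw [prod_mul_distrib, prod_const, prod_ite, hfilter, prod_const, prod_const_one, mul_one,
            card_erase_of_mem hx]
      _ ≤ _ := by
          refine prod_le_prod (fun y _ ↦ by split_ifs <;> positivity) fun y hy ↦ ?_
          obtain ⟨hyx, hyX⟩ := mem_erase.1 hy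
          refine le_trans ?_ (two_div_pi_mul_abs_le_norm_exp_sub (hπ x (hPX j hx) y hyX))
          split_ifs with hyj
          · exact mul_le_mul hκ1 (hin j x hx y hyj hyx.symm) hh (by positivity)
          · rw [mul_one]
            refine hκη.trans ?_
            gcongr
            exact hout j x hx y (mem_sdiff.2 ⟨hyX, hyj⟩)
  rw [sq_prod_singularValues_squareVandermonde]
  calc κ ^ (#X * #X) * h ^ (∑ j, #(P j) * (#(P j) - 1))
      = ∏ j, ∏ _x ∈ P j, κ ^ #X * h ^ (#(P j) - 1) := by
        simp_rw [prod_const, mul_pow, ← pow_mul]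
        rw [prod_mul_distrib, prod_pow_eq_pow_sum, prod_pow_eq_pow_sum, ← mul_sum, ← hcard]
        simp_rw [mul_comm]
    _ ≤ ∏ j, ∏ x ∈ P j, ∏ y ∈ X.erase x,
        ‖Complex.exp (Complex.I * (y : ℂ)) - Complex.exp (Complex.I * (x : ℂ))‖ :=
        prod_le_prod (fun j _ ↦ by positivity) fun j _ ↦
          prod_le_prod (fun x _ ↦ by positivity) fun x hx ↦ key j x hx
    _ = _ := by rw [← prod_biUnion hpd, hunion]

end SuperResolution

theorem mainTheorem4 (n : ℕ) (ν η : ℝ) (hη : 0 < η) :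
    ∃ c C : ℝ, 0 < c ∧ 0 < C ∧
      ∀ (X : Finset ℝ) (M : ℕ) (νs : Fin M → ℝ) (ns : Fin M → ℕ),
        X.card = n →
        (∀ x ∈ X, x ∈ Set.Ioc (-(Real.pi / 2)) (Real.pi / 2)) →
        (∀ j, νs j ≤ ν) →
        SuperResolution.IsClusteredConfiguration X
          (fun _ => SuperResolution.minSep X) νs ns η →
        (∑ m ∈ Finset.Icc 1 (SuperResolution.maxSize ns),
            SuperResolution.numClusters ns m = n) ∧
        ∀ m ∈ Finset.Icc 1 (SuperResolution.maxSize ns),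
          ∀ i ∈ Finset.Icc 1 (SuperResolution.numClusters ns m),
            c * SuperResolution.minSep X ^ (m - 1) ≤
              SuperResolution.groupSingularValue (SuperResolution.squareVandermonde X)
                (SuperResolution.numClusters ns) m i ∧
            SuperResolution.groupSingularValue (SuperResolution.squareVandermonde X)
                (SuperResolution.numClusters ns) m i ≤
              C * SuperResolution.minSep X ^ (m - 1) := by
  -- `C` comes from Taylor's formula with cluster diameter at most `max ν 1 * Δ`; `κ` bounds the
  -- chord `|e^{ix} - e^{iy}|` from below by `κ Δ` inside a cluster and by `κ` across clusters.
  set ν' : ℝ := max ν 1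
  set κ : ℝ := min (2 / Real.pi) (2 / Real.pi * η)
  set C : ℝ := 1 + n ^ 2 * ((n * ν' + 1) ^ n * Real.exp (n * Real.pi)) with hC
  have hν0 : 0 ≤ ν' := zero_le_one.trans (le_max_right _ _)
  have hκ0 : 0 < κ := lt_min (by positivity) (by positivity)
  have hκ1 : κ ≤ 1 := (min_le_left _ _).trans ((div_le_one Real.pi_pos).2 Real.two_le_pi)
  have hC1 : 1 ≤ C := le_add_of_nonneg_right (by positivity)
  refine ⟨κ ^ (n * n) / C ^ n, C, by positivity, by positivity, ?_⟩
  rintro X M νs ns rfl hX hνs ⟨-, P, hne, hdisj, hunion, hP⟩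
  obtain rfl : ns = fun j ↦ #(P j) := funext fun j ↦ ((hP j).1.1).symm
  have hD0 : 0 ≤ minSep X := minSep_nonneg X
  have hPX (j : Fin M) : P j ⊆ X := hunion ▸ subset_biUnion_of_mem P (mem_univ j)
  have hlt : ∀ x ∈ X, ∀ y ∈ X, |x - y| < Real.pi := fun x hx y hy ↦ by
    obtain ⟨h1, h2⟩ := hX x hx
    obtain ⟨h3, h4⟩ := hX y hy
    rw [abs_lt]
    constructor <;> linarith
  have htorus : ∀ x ∈ X, ∀ y ∈ X, torusNorm (x - y) = |x - y| := fun x hx y hy ↦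
    torusNorm_eq_abs (hlt x hx y hy)
  have hin : ∀ j, ∀ x ∈ P j, ∀ y ∈ P j, x ≠ y →
      minSep X ≤ |x - y| ∧ |x - y| ≤ νs j * minSep X := fun j x hx y hy hxy ↦ by
    rw [← htorus x (hPX j hx) y (hPX j hy)]
    exact (hP j).1.2 y hy x hx hxy.symm
  have hdiam : ∀ j, ∀ x ∈ P j, ∀ y ∈ P j, |x - y| ≤ ν' * minSep X := fun j x hx y hy ↦ by
    rcases eq_or_ne x y with rfl | hxy
    · rw [sub_self, abs_zero]
      positivity
    · refine (hin j x hx y hy hxy).2.trans ?_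
      gcongr
      exact (hνs j).trans (le_max_left _ _)
  have hsum : ∑ m ∈ Icc 1 (maxSize fun j ↦ #(P j)), numClusters (fun j ↦ #(P j)) m = #X := by
    rw [sum_numClusters, ← card_biUnion fun i _ j _ hij ↦ hdisj i j hij, hunion]
  refine ⟨hsum, ?_⟩
  set l : ℕ → ℕ := numClusters fun j ↦ #(P j) with hl
  set s : ℕ := maxSize fun j ↦ #(P j)
  have hsn : s ≤ #X := Finset.sup_le fun j _ ↦ card_le_card (hPX j)
  -- A group `m ≥ 2` is only present when some cluster has two nodes, and then `Δ > 0`.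
  have hpow : ∀ m ∈ Icc 1 s, 0 < minSep X ^ (m - 1) := fun m hm ↦ by
    obtain ⟨h1, h2⟩ := mem_Icc.1 hm
    rcases h1.eq_or_lt with rfl | h1
    · simp
    obtain ⟨j, -, hj⟩ := Finset.lt_sup_iff.1 (h1.trans_le h2)
    obtain ⟨x, hx, y, hy, hxy⟩ := one_lt_card.1 hj
    refine pow_pos (hD0.lt_of_ne fun h0 ↦ ?_) _
    have := (hin j x hx y hy hxy).2
    rw [← h0, mul_zero] at this
    exact hxy (sub_eq_zero.1 (abs_nonpos_iff.1 this))
  have hupper : ∀ m ∈ Icc 1 s, ∀ i ∈ Icc 1 (l m),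
      groupSingularValue (squareVandermonde X) l m i ≤ C * minSep X ^ (m - 1) := by
    intro m hm i hi
    obtain ⟨h1, h2⟩ := mem_Icc.1 hm
    have hi1 := (mem_Icc.1 hi).1
    have hB := singularValues_squareVandermonde_le hne hdisj hunion (by positivity) hdiam
      (fun x hx y hy ↦ (hlt x hx y hy).le) (m - 1)
    rw [← sum_numClusters_Ico _ h1, ← hl] at hB
    calc _ ≤ _ := LinearMap.singularValues_antitone _ (by omega)
      _ ≤ _ := hB
      _ = #X ^ 2 * ((#X * ν') ^ (m - 1) * Real.exp (#X * Real.pi)) * minSep X ^ (m - 1) := by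
        rw [← mul_assoc (#X : ℝ) ν', mul_pow]
        ring
      _ ≤ C * minSep X ^ (m - 1) := by
        gcongr
        rw [hC]
        refine le_trans ?_ (le_add_of_nonneg_left zero_le_one)
        gcongr
        calc (#X * ν') ^ (m - 1) ≤ (#X * ν' + 1) ^ (m - 1) := by gcongr; linarith
          _ ≤ (#X * ν' + 1) ^ #X :=
            pow_le_pow_right₀ (le_add_of_nonneg_left (by positivity)) (by omega)
  intro m hm i hi
  refine ⟨?_, hupper m hm i hi⟩
  let T : Finset ((_ : ℕ) × ℕ) := (Icc 1 s).sigma fun m ↦ Icc 1 (l m)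
  have hT : #T = #X := by simp [T, card_sigma, hsum]
  have hprod : κ ^ (#X * #X) * ∏ p ∈ T, minSep X ^ (p.1 - 1)
      ≤ ∏ p ∈ T, groupSingularValue (squareVandermonde X) l p.1 p.2 := by
    have h1 : ∏ p ∈ T, groupSingularValue (squareVandermonde X) l p.1 p.2
        = ∏ t ∈ range #X, (Matrix.toEuclideanLin (squareVandermonde X)).singularValues t := by
      have h := prod_range_eq_prod_blocks
        (Matrix.toEuclideanLin (squareVandermonde X)).singularValues l s
      rw [hsum] at h
      rw [h, prod_sigma]
      rfl
    have h2 : ∏ p ∈ T, minSep X ^ (p.1 - 1) = minSep X ^ ∑ m ∈ Icc 1 s, l m * (m - 1) := by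
      rw [prod_sigma, ← prod_pow_eq_pow_sum]
      refine prod_congr rfl fun m _ ↦ ?_
      dsimp only
      rw [prod_const, Nat.card_Icc, add_tsub_cancel_right, ← pow_mul, mul_comm]
    rw [h1, h2]
    refine le_of_sq_le_sq ?_ (prod_nonneg fun t _ ↦ LinearMap.singularValues_nonneg _ t)
    refine le_trans ?_ (le_sq_prod_singularValues_squareVandermonde hdisj hunion
      (fun j x hx y hy hxy ↦ (hin j x hx y hy hxy).1)
      (fun j x hx y hy ↦ htorus x (hPX j hx) y (mem_sdiff.1 hy).1 ▸ (hP j).2 x hx y hy)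
      (fun x hx y hy ↦ (hlt x hx y hy).le) hD0 hκ0.le (min_le_left _ _) (min_le_right _ _))
    rw [← two_mul_sum_numClusters_mul_pred, mul_pow, ← pow_mul (minSep X), mul_comm _ 2]
    gcongr
    exact pow_le_of_le_one (by positivity) (pow_le_one₀ hκ0.le hκ1) two_ne_zero
  have := le_of_prod_le (T := T) hC1 (fun p hp ↦ hpow p.1 (mem_sigma.1 hp).1)
    (fun p _ ↦ LinearMap.singularValues_nonneg _ _)
    (fun p hp ↦ hupper p.1 (mem_sigma.1 hp).1 p.2 (mem_sigma.1 hp).2) hprod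
    (t := ⟨m, i⟩) (mem_sigma.2 ⟨hm, hi⟩)
  rwa [hT] at this
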